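/- Let $n\ge 1$ and $m\ge 2$ be integers and let $S=\mathbb{R}[x_{ij},y_{ij}:1\le i,j\le n]$ be the polynomial ring in $2n^2$ variables. Let $A_1,\dots,A_{m-1}$ be complex $n\times n$ matrices (for instance, the matrices whose columns are the vectors of the bases in a system of $m-1$ mutually unbiased bases of $\mathbb{C}^n$) with $A_1=I_n$, and write the entries of $A_l$ as $b^{(l)}_{iq}+\sqrt{-1}\,c^{(l)}_{iq}$ with $b^{(l)}_{iq},c^{(l)}_{iq}\in\mathbb{R}$. For $1\le l\le m-1$ let $$J_{l,m}^{\{n\}}=\Big(\Big\{\sum_{i=1}^{n}\big(x_{ij}b^{(l)}_{iq}+y_{ij}c^{(l)}_{iq}\big)\Big\}^2+\Big\{\sum_{i=1}^{n}\big(b^{(l)}_{iq}y_{ij}-x_{ij}c^{(l)}_{iq}\big)\Big\}^2-\frac1n \;:\; 1\le j,q\le n\Big)\subseteq S .$$ Then $\operatorname{ht}\big(J_{1,m}^{\{n\}}\big)=n^2$. (Since $A_1=I_n$, the ideal $J_{1,m}^{\{n\}}$ is the sphere ideal $\big(x_{ij}^2+y_{ij}^2-\tfrac1n:1\le i,j\le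 n\big)$.) Here the height of an ideal $I$ is the minimum of the heights of the prime ideals containing $I$, and the height of a prime ideal $P$ is the supremum of the lengths of chains of prime ideals ending at $P$. -/

import Mathlib

open scoped Matrix

noncomputable section

/-- Index set of the `2 n ^ 2` real variables `x_{ij}` (left) and `y_{ij}` (right). -/
abbrev MUBVar (n : ℕ) : Type := (Fin n × Fin n) ⊕ (Fin n × Fin n)

/-- The polynomial ring `ℝ[x_{ij}, y_{ij} : 1 ≤ i, j ≤ n]`. -/
abbrev MUBRing (n : ℕ) : Type := MvPolynomial (MUBVar n) ℝ

/-- The variable `x_{ij}`, the real part of the `i`-th coordinate of the `j`-th new vector. -/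
def xVar {n : ℕ} (i j : Fin n) : MUBRing n := MvPolynomial.X (Sum.inl (i, j))

/-- The variable `y_{ij}`, the imaginary part of the `i`-th coordinate of the `j`-th new vector. -/
def yVar {n : ℕ} (i j : Fin n) : MUBRing n := MvPolynomial.X (Sum.inr (i, j))

/-- The polynomial expressing `|⟨z_j, a_q⟩|² - 1/n`, where `a_q` is the `q`-th column of `A`,
with entries `a_{iq} = b_{iq} + i c_{iq}`:
`(∑ i, (x_{ij} b_{iq} + y_{ij} c_{iq}))² + (∑ i, (b_{iq} y_{ij} - x_{ij} c_{iq}))² - 1/n`. -/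
def mubPoly {n : ℕ} (A : Matrix (Fin n) (Fin n) ℂ) (j q : Fin n) : MUBRing n :=
  (∑ i, (xVar i j * MvPolynomial.C (A i q).re + yVar i j * MvPolynomial.C (A i q).im)) ^ 2
    + (∑ i, (MvPolynomial.C (A i q).re * yVar i j - xVar i j * MvPolynomial.C (A i q).im)) ^ 2
    - MvPolynomial.C (1 / (n : ℝ))

/-- For matrices `A_1, …, A_{m-1}` (columns being the basis vectors; `A_l` is `A` at index `l - 1`),
the ideal `J_{l,m}` generated by the unbiasedness relations between `A_l` and the
unknown `m`-th basis. -/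
def mubIdeal {n m : ℕ} (A : Fin (m - 1) → Matrix (Fin n) (Fin n) ℂ) (l : Fin (m - 1)) :
    Ideal (MUBRing n) :=
  Ideal.span {f | ∃ j q : Fin n, f = mubPoly (A l) j q}

end

/-! The ideal has `n ^ 2` generators and a real zero, so Krull's height theorem bounds its height
above by `n ^ 2`. For the lower bound, take any prime above it: each generator is a monic quadratic
in one `x` over the polynomial ring in the `y`s. Eliminating the `x`s one at a time, each
contraction lowers the height by at least one (`height_comap_C_add_one_le_of_monic_mem`). -/

namespace Ideal

/-- A prime of `R[X]` containing a monic polynomial has height strictly larger than its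
contraction to `R`. -/
theorem height_comap_C_add_one_le_of_monic_mem {R : Type*} [CommRing R] [IsNoetherianRing R]
    (P : Ideal (Polynomial R)) [P.IsPrime] {f : Polynomial R} (hf : f.Monic) (hfP : f ∈ P) :
    (P.comap Polynomial.C).height + 1 ≤ P.height := by
  set p := P.comap Polynomial.C with hp
  have : p.IsPrime := hp ▸ inferInstance
  have hcomap : (p.map Polynomial.C).comap Polynomial.C = p :=
    le_antisymm (fun r hr ↦ by
      have := Ideal.mem_map_C_iff.mp (Ideal.mem_comap.mp hr) 0
      simpa using this) Ideal.le_comap_map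
  have : (p.map Polynomial.C).LiesOver p := ⟨hcomap.symm⟩
  -- `R[X]` is flat over `R`, so going down holds.
  have hle : p.height ≤ (p.map Polynomial.C).height := by
    rw [height_eq_height_add_of_liesOver_of_hasGoingDown p (p.map Polynomial.C)]
    exact le_self_add
  -- Every coefficient of a member of `p R[X]` lies in `p`, which excludes monic polynomials.
  have hlt : p.map Polynomial.C < P := by
    refine lt_of_le_of_ne Ideal.map_comap_le fun h ↦ ?_
    have := Ideal.mem_map_C_iff.mp (h ▸ hfP) f.natDegree
    rw [hf.coeff_natDegree] at this
    exact (Ideal.ne_top_iff_one p).mp Ideal.IsPrime.ne_top' this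
  exact (add_le_add_left hle 1).trans (height_add_one_le_of_lt_of_isPrime hlt)

/-- A prime of `R[X₀, …, Xₙ₋₁]` modulo which every variable is integral over `R` has height at
least `n`. -/
theorem le_height_of_forall_monic_aeval_mem {R : Type*} [CommRing R] [IsNoetherianRing R] (n : ℕ)
    (P : Ideal (MvPolynomial (Fin n) R)) [P.IsPrime]
    (h : ∀ i, ∃ g : Polynomial R, g.Monic ∧ Polynomial.aeval (MvPolynomial.X i) g ∈ P) :
    (n : ℕ∞) ≤ P.height := by
  induction n with
  | zero => simp
  | succ n ih =>
    let e := MvPolynomial.finSuccEquiv R n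
    let Q : Ideal (Polynomial (MvPolynomial (Fin n) R)) := P.comap e.symm.toRingEquiv
    have hQ : Q.height = P.height := e.symm.toRingEquiv.height_comap P
    have hmem (i : Fin (n + 1)) (g : Polynomial R)
        (hg : Polynomial.aeval (MvPolynomial.X i) g ∈ P) :
        Polynomial.aeval (e (MvPolynomial.X i)) g ∈ Q := by
      change e.symm _ ∈ P
      rwa [← Polynomial.aeval_algHom_apply e.symm, e.symm_apply_apply]
    have : Q.IsPrime := Ideal.comap_isPrime _ _
    have hn : (n : ℕ∞) ≤ (Q.comap Polynomial.C).height := by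
      refine ih _ fun i ↦ ?_
      obtain ⟨g, hg, hgP⟩ := h i.succ
      refine ⟨g, hg, ?_⟩
      have := hmem _ g hgP
      rw [MvPolynomial.finSuccEquiv_X_succ] at this
      change Polynomial.CAlgHom (R := R) _ ∈ Q
      rwa [← Polynomial.aeval_algHom_apply]
    obtain ⟨g, hg, hgP⟩ := h 0
    have hgQ := hmem _ g hgP
    rw [MvPolynomial.finSuccEquiv_X_zero, ← Polynomial.aeval_map_algebraMap
      (MvPolynomial (Fin n) R), Polynomial.aeval_X_left_apply] at hgQ
    rw [← hQ, Nat.cast_add, Nat.cast_one]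
    exact (add_le_add_left hn 1).trans
      (height_comap_C_add_one_le_of_monic_mem Q (hg.map _) hgQ)

/-- A prime of `R[Xᵢ : i ∈ σ]` modulo which every variable is integral over `R` has height at
least the number of variables. -/
theorem card_le_height_of_forall_monic_aeval_mem {R σ : Type*} [CommRing R] [IsNoetherianRing R]
    [Fintype σ] (P : Ideal (MvPolynomial σ R)) [P.IsPrime]
    (h : ∀ i, ∃ g : Polynomial R, g.Monic ∧ Polynomial.aeval (MvPolynomial.X i) g ∈ P) :
    (Fintype.card σ : ℕ∞) ≤ P.height := by
  let e := MvPolynomial.renameEquiv R (Fintype.equivFin σ).symm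
  rw [← e.toRingEquiv.height_comap P]
  have : (P.comap e.toRingEquiv).IsPrime := Ideal.comap_isPrime _ _
  refine le_height_of_forall_monic_aeval_mem _ _ fun i ↦ ?_
  obtain ⟨g, hg, hgP⟩ := h ((Fintype.equivFin σ).symm i)
  refine ⟨g, hg, ?_⟩
  change e _ ∈ P
  rw [← Polynomial.aeval_algHom_apply e]
  simpa [e] using hgP

end Ideal

theorem mubPoly_one {n : ℕ} (j q : Fin n) :
    mubPoly 1 j q = xVar q j ^ 2 + yVar q j ^ 2 - MvPolynomial.C (1 / (n : ℝ)) := by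
  have hre (i : Fin n) : ((1 : Matrix (Fin n) (Fin n) ℂ) i q).re = if i = q then 1 else 0 := by
    rw [Matrix.one_apply]; split_ifs <;> simp
  have him (i : Fin n) : ((1 : Matrix (Fin n) (Fin n) ℂ) i q).im = 0 := by
    rw [Matrix.one_apply]; split_ifs <;> simp
  simp [mubPoly, hre, him, apply_ite (MvPolynomial.C (σ := MUBVar n) (R := ℝ))]

/-- The ideal generated by the polynomials `mubPoly 1 j q` is proper: they have a common zero. -/
theorem span_range_mubPoly_one_ne_top (n : ℕ) :
    Ideal.span (Set.range fun a : Fin n × Fin n ↦ mubPoly 1 a.1 a.2) ≠ ⊤ := by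
  let φ : MUBRing n →+* ℝ :=
    MvPolynomial.eval (Sum.elim (fun _ ↦ Real.sqrt (1 / (n : ℝ))) fun _ ↦ 0)
  refine ne_top_of_le_ne_top (RingHom.ker_ne_top φ) (Ideal.span_le.mpr ?_)
  rintro _ ⟨⟨j, q⟩, rfl⟩
  have hn : (0 : ℝ) ≤ 1 / n := by positivity
  change φ (mubPoly 1 j q) = 0
  rw [mubPoly_one]
  simp only [φ, xVar, yVar, map_sub, map_add, map_pow, MvPolynomial.eval_X, MvPolynomial.eval_C,
    Sum.elim_inl, Sum.elim_inr, Real.sq_sqrt hn]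
  ring

/-- A prime containing all the polynomials `mubPoly 1 j q` has height at least `n ^ 2`, since each
`x_{qj}` is integral modulo it over the polynomial ring in the `y_{ij}`. -/
theorem sq_le_height_of_mubPoly_one_mem {n : ℕ} (P : Ideal (MUBRing n)) [P.IsPrime]
    (h : ∀ j q : Fin n, mubPoly 1 j q ∈ P) : (n : ℕ∞) ^ 2 ≤ P.height := by
  -- The `x`s become the variables, and the `y`s move into the coefficient ring.
  let e := MvPolynomial.sumAlgEquiv ℝ (Fin n × Fin n) (Fin n × Fin n)
  rw [← e.symm.toRingEquiv.height_comap P]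
  have : (P.comap e.symm.toRingEquiv).IsPrime := Ideal.comap_isPrime _ _
  have hcard : ((n : ℕ∞) ^ 2) = (Fintype.card (Fin n × Fin n) : ℕ∞) := by simp [sq]
  rw [hcard]
  refine Ideal.card_le_height_of_forall_monic_aeval_mem _ fun a ↦ ?_
  let c : MvPolynomial (Fin n × Fin n) ℝ :=
    MvPolynomial.X a ^ 2 - MvPolynomial.C (1 / (n : ℝ))
  refine ⟨Polynomial.X ^ 2 + Polynomial.C c, Polynomial.monic_X_pow_add_C c two_ne_zero, ?_⟩
  change e.symm _ ∈ P
  -- The indices swap because `mubPoly 1 j q` involves `xVar q j`.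
  convert h a.2 a.1 using 1
  rw [mubPoly_one, AlgEquiv.symm_apply_eq]
  simp only [e, c, xVar, yVar, map_add, map_sub, map_pow, Polynomial.aeval_X, Polynomial.aeval_C,
    MvPolynomial.sumAlgEquiv_X_inl, MvPolynomial.sumAlgEquiv_X_inr,
    MvPolynomial.sumAlgEquiv_C_inl, MvPolynomial.algebraMap_eq]
  ring

theorem mainTheorem5 (n m : ℕ) (hm : 2 ≤ m)
    (A : Fin (m - 1) → Matrix (Fin n) (Fin n) ℂ)
    (hA : A ⟨0, by omega⟩ = 1) :
    (mubIdeal A ⟨0, by omega⟩).height = (n : ℕ∞) ^ 2 := by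
  have hI : mubIdeal A ⟨0, by omega⟩ =
      Ideal.span (Set.range fun a : Fin n × Fin n ↦ mubPoly 1 a.1 a.2) := by
    rw [mubIdeal, hA]
    congr 1
    ext f
    simp [eq_comm]
  rw [hI]
  refine le_antisymm ?_ ?_
  · obtain ⟨P, hP⟩ := Ideal.nonempty_minimalPrimes (span_range_mubPoly_one_ne_top n)
    have : P.IsPrime := hP.isPrime
    refine (Ideal.height_mono hP.le).trans
      ((Ideal.height_le_card_of_mem_minimalPrimes_span (Set.finite_range _) hP).trans ?_)
    have := Finite.card_range_le fun a : Fin n × Fin n ↦ mubPoly 1 a.1 a.2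
    rw [Nat.card_coe_set_eq] at this
    rw [sq]
    exact_mod_cast this.trans (by simp)
  · rw [Ideal.height_eq_inf_minimalPrimes]
    refine le_iInf₂ fun P hP ↦ ?_
    have : P.IsPrime := hP.isPrime
    exact sq_le_height_of_mubPoly_one_mem P fun j q ↦
      hP.le (Ideal.subset_span ⟨(j, q), rfl⟩)
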